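/- Let $K$ be a field, let $0\le N\le M$ be integers, let $\beta\in K$, $\beta\ne 0$. For a sequence of integers $\lambda_1\ge\dots\ge\lambda_N\ge 0$ and $\boldsymbol z=(z_1,\dots,z_N)\in K^N$ with pairwise distinct entries put $$G_\lambda(\boldsymbol z;\beta)=\frac{\det\left[z_j^{\lambda_k+N-k}(1+\beta z_j)^{k-1}\right]_{j,k=1}^N}{\prod_{1\le j<k\le N}(z_j-z_k)},$$ and, if all $z_j\neq0$ and $1+\beta z_j^{-1}\ne 0$, put $$\overline G_\lambda(\boldsymbol z;\beta)=\frac{\det\left[z_j^{\lambda_k+N-k}(1+\beta z_j^{-1})^{1-k}\right]_{j,k=1}^N}{\prod_{1\le j<k\le N}(z_j-z_k)}$$ (the Grothendieck polynomial and its dual). Write $\lambda\subseteq(M-N)^N$ for $M-N\ge\lambda_1\ge\dots\ge\lambda_N\ge0$, and $|\lambda|=\sum_{j=1}^N\lambda_j$. (1) For all pairwise distinct $z_1,\dots,z_N\in K$, $$\sum_{\lambda\subseteq(M-N)^N}(-\beta)^{|\lambda|}G_\lambda(\boldsymbol z;\beta)=\prod_{1\le j<k\le N}\frac1{z_k-z_j}\;\det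 V^{(M)},$$ where $V^{(M)}$ is the $N\times N$ matrix with entries $$V^{(M)}_{jk}=\sum_{m=0}^{j-1}(-1)^m(-\beta)^{j-N}\binom Mm(1+\beta z_k)^{m-j+N-1}\quad(1\le j\le N-1),$$ $$V^{(M)}_{Nk}=-\sum_{m=\max(N-1,1)}^M(-1)^m\binom Mm(1+\beta z_k)^{m-1}.$$ (2) For all pairwise distinct nonzero $y_1,\dots,y_N\in K$ with $1+\beta y_j^{-1}\neq0$ for all $j$, $$\sum_{\lambda\subseteq(M-N)^N}(-\beta)^{-|\lambda|}\,\overline G_\lambda(\boldsymbol y;\beta)=\prod_{j=1}^Ny_j^{M-1}\prod_{1\le j<k\le N}\frac1{y_k-y_j}\;\det\widetilde V^{(M)},$$ where $\widetilde V^{(M)}$ is the $N\times N$ matrix with entries $$\widetilde V^{(M)}_{jk}=\sum_{m=0}^{N-j}(-1)^m(-\beta)^{-j+1-M+N}\binom Mm(1+\beta y_k^{-1})^{m+j-N-1}\quad(2\le j\le N),$$ $$\widetilde V^{(M)}_{1k}=-\sum_{m=\max(N-1,1)}^M(-1)^m(-\beta)^{-M+N}\binom Mm(1+\beta y_k^{-1})^{m-N}.$$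 Here $x^0=1$ for every $x\in K$, including $x=0$. -/

import Mathlib

/-- The Young diagrams contained in the rectangle with `N` rows and `L` columns, i.e. the sequences
`L ≥ μ 0 ≥ μ 1 ≥ ⋯ ≥ μ (N - 1) ≥ 0` of natural numbers. -/
def boxPartitions (L N : ℕ) : Finset (Fin N → ℕ) :=
  {μ ∈ Fintype.piFinset (fun _ : Fin N => Finset.range (L + 1)) |
    ∀ i j : Fin N, i ≤ j → μ j ≤ μ i}

/-- The product of `z j - z k` over all `j < k`. -/
def diffProd {K : Type*} [Field K] {N : ℕ} (z : Fin N → K) : K :=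
  ∏ j : Fin N, ∏ k ∈ Finset.Ioi j, (z j - z k)

/-- The Grothendieck polynomial: determinant of `z_j ^ (μ_k + N - k) * (1 + β z_j) ^ (k - 1)`
(`1 ≤ j, k ≤ N`) divided by the product of `z_j - z_k` over `j < k`.
The index `k : Fin N` starts at `0`, so it stands for the index `k + 1` of the formula. -/
def grothendieck {K : Type*} [Field K] {N : ℕ} (μ : Fin N → ℕ) (z : Fin N → K) (β : K) : K :=
  (Matrix.of fun j k : Fin N =>
      z j ^ (μ k + (N - (k.val + 1))) * (1 + β * z j) ^ k.val).det / diffProd z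

/-- The dual Grothendieck polynomial: determinant of
`y_j ^ (μ_k + N - k) * (1 + β y_j⁻¹) ^ (1 - k)` (`1 ≤ j, k ≤ N`) divided by the product of
`y_j - y_k` over `j < k`. -/
def dualGrothendieck {K : Type*} [Field K] {N : ℕ} (μ : Fin N → ℕ) (y : Fin N → K) (β : K) : K :=
  (Matrix.of fun j k : Fin N =>
      y j ^ (μ k + (N - (k.val + 1))) *
        (1 + β * (y j)⁻¹) ^ (1 - ((k.val : ℤ) + 1))).det / diffProd y

/-- The entry in row `j` (`1 ≤ j ≤ N`) of the column of `V` that belongs to the variable `z`. -/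
def vEntry {K : Type*} [Field K] (M N : ℕ) (β : K) (j : ℕ) (z : K) : K :=
  if j < N then
    ∑ m ∈ Finset.range j,
      (-1) ^ m * (-β) ^ ((j : ℤ) - N) * (M.choose m : K) *
        (1 + β * z) ^ ((m : ℤ) - j + N - 1)
  else
    -∑ m ∈ Finset.Icc (max (N - 1) 1) M,
      (-1) ^ m * (M.choose m : K) * (1 + β * z) ^ ((m : ℤ) - 1)

/-- The matrix `V`; the row and column indices in `Fin N` start at `0`. -/
def vMatrix {K : Type*} [Field K] (M : ℕ) {N : ℕ} (β : K) (z : Fin N → K) :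
    Matrix (Fin N) (Fin N) K :=
  Matrix.of fun j k => vEntry M N β (j.val + 1) (z k)

/-- The entry in row `j` (`1 ≤ j ≤ N`) of the column of `Ṽ` that belongs to the variable `y`. -/
def vTildeEntry {K : Type*} [Field K] (M N : ℕ) (β : K) (j : ℕ) (y : K) : K :=
  if 2 ≤ j then
    ∑ m ∈ Finset.range (N - j + 1),
      (-1) ^ m * (-β) ^ (-(j : ℤ) + 1 - M + N) * (M.choose m : K) *
        (1 + β * y⁻¹) ^ ((m : ℤ) + j - N - 1)
  else
    -∑ m ∈ Finset.Icc (max (N - 1) 1) M,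
      (-1) ^ m * (-β) ^ (-(M : ℤ) + N) * (M.choose m : K) *
        (1 + β * y⁻¹) ^ ((m : ℤ) - N)

/-- The matrix `Ṽ`; the row and column indices in `Fin N` start at `0`. -/
def vTildeMatrix {K : Type*} [Field K] (M : ℕ) {N : ℕ} (β : K) (y : Fin N → K) :
    Matrix (Fin N) (Fin N) K :=
  Matrix.of fun j k => vTildeEntry M N β (j.val + 1) (y k)

/-! Put N = n + 1, M = L + n + 1 and w = 1 + βz, so that -βz = 1 - w. Reversing the indices and
moving the powers of -β into the rows turns the summand of (1), up to a factor independent of λ,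
into the determinant with rows W_i(ν_i) = (1 - w)^(ν_i + i) w^(n - i), where ν is weakly increasing.
The sum of W_i(a) over a ≤ b is c_i - W_{i+1}(b), with c_i = (1 - w)^i w^(n - 1 - i). At b = ν_{i+1}
the subtracted term is the next row, so it drops out of the determinant: the sum telescopes to a
single determinant (`sum_monotoneBox_alternatingMap`, `sum_monotoneBox_det`).

That determinant and det V, freed of its powers of -β, have rows w^(n - 1 - i) q_i(w) for i < n,
with deg q_i ≤ i and q_i(0) = 1; their last rows agree modulo polynomials in w of degree < n.
Unitriangular row operations bring both to the same form (`det_geom_rows_eq`).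

Part (2) is part (1) at z = 1/y, after replacing λ by its complement in the rectangle. -/

/-! ### Telescoping over weakly increasing sequences. -/

/-- The weakly increasing sequences of length `n` with values in `{0, …, L}`. -/
def monotoneBox (L n : ℕ) : Finset (Fin n → ℕ) :=
  {ν ∈ Fintype.piFinset (fun _ : Fin n => Finset.range (L + 1)) | ∀ i j : Fin n, i ≤ j → ν i ≤ ν j}

theorem mem_monotoneBox {L n : ℕ} {ν : Fin n → ℕ} :
    ν ∈ monotoneBox L n ↔ (∀ i, ν i ≤ L) ∧ ∀ i j, i ≤ j → ν i ≤ ν j := by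
  simp [monotoneBox, Fintype.mem_piFinset]

theorem mem_boxPartitions {L n : ℕ} {μ : Fin n → ℕ} :
    μ ∈ boxPartitions L n ↔ (∀ i, μ i ≤ L) ∧ ∀ i j, i ≤ j → μ j ≤ μ i := by
  simp [boxPartitions, Fintype.mem_piFinset]

theorem sum_monotoneBox_succ_succ {F : Type*} [AddCommMonoid F] (L n : ℕ)
    (g : (Fin (n + 2) → ℕ) → F) :
    ∑ ν ∈ monotoneBox L (n + 2), g ν =
      ∑ ν ∈ monotoneBox L (n + 1), ∑ a ∈ Finset.range (ν 0 + 1), g (Fin.cons a ν) := by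
  rw [Finset.sum_sigma']
  refine Finset.sum_nbij' (fun ν => ⟨Fin.tail ν, ν 0⟩) (fun p => Fin.cons p.2 p.1) ?_ ?_ ?_ ?_ ?_
  · intro ν hν
    rw [mem_monotoneBox] at hν
    simp only [Finset.mem_sigma, mem_monotoneBox, Finset.mem_range, Nat.lt_succ_iff]
    exact ⟨⟨fun i => hν.1 _, fun i j hij => hν.2 _ _ (Fin.succ_le_succ_iff.2 hij)⟩,
      hν.2 _ _ (Fin.zero_le _)⟩
  · rintro ⟨ν, a⟩ h
    simp only [Finset.mem_sigma, mem_monotoneBox, Finset.mem_range, Nat.lt_succ_iff] at h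
    obtain ⟨⟨h1, h2⟩, h3⟩ := h
    rw [mem_monotoneBox]
    refine ⟨fun i => ?_, fun i j hij => ?_⟩
    · refine Fin.cases ?_ (fun i => ?_) i
      · simpa using h3.trans (h1 0)
      · simpa using h1 i
    · revert hij
      refine Fin.cases (fun _ => ?_) (fun i => ?_) i
      · refine Fin.cases ?_ (fun j => ?_) j
        · simp
        · simpa using h3.trans (h2 0 j (Fin.zero_le _))
      · refine Fin.cases (fun hij => ?_) (fun j hij => ?_) j
        · exact absurd hij (by simp)
        · simpa using h2 i j (Fin.succ_le_succ_iff.1 hij)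
  · intro ν _
    exact Fin.cons_self_tail ν
  · rintro ⟨ν, a⟩ _
    simp
  · intro ν _
    simp

/-- A sum of values of an alternating map over weakly increasing index sequences telescopes if the
partial sums of each family are differences of a constant and the next family. -/
theorem sum_monotoneBox_alternatingMap {R E F : Type*} [CommRing R] [AddCommGroup E] [Module R E]
    [AddCommGroup F] [Module R F] (L n : ℕ) (f : E [⋀^Fin (n + 1)]→ₗ[R] F) (W : ℕ → ℕ → E)
    (c : ℕ → E)
    (h : ∀ i < n, ∀ b, ∑ a ∈ Finset.range (b + 1), W i a = c i - W (i + 1) b) :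
    ∑ ν ∈ monotoneBox L (n + 1), f (fun i => W i (ν i)) =
      f (fun i => if i.val < n then c i else ∑ a ∈ Finset.range (L + 1), W n a) := by
  induction n generalizing W c with
  | zero =>
    -- In one variable an alternating map is just linear.
    have key : ∀ v : Fin 1 → E, f v = f.toMultilinearMap.toLinearMap 0 0 (v 0) := by
      intro v
      simp only [MultilinearMap.toLinearMap_apply, AlternatingMap.coe_multilinearMap]
      congr 1
      ext i
      fin_cases i
      simp
    simp only [key]
    simp only [Fin.val_zero, lt_irrefl, if_false, map_sum]
    refine Finset.sum_nbij' (fun ν => ν 0) (fun a _ => a) ?_ ?_ ?_ ?_ ?_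
    · intro ν hν
      simpa [Nat.lt_succ_iff] using (mem_monotoneBox.1 hν).1 0
    · intro a ha
      rw [Finset.mem_range, Nat.lt_succ_iff] at ha
      exact mem_monotoneBox.2 ⟨fun _ => ha, fun _ _ _ => le_rfl⟩
    · intro ν _
      ext i
      fin_cases i
      rfl
    · intro a _
      rfl
    · intro ν _
      rfl
  | succ n ih =>
    rw [sum_monotoneBox_succ_succ]
    have split : ∀ (ν : Fin (n + 1) → ℕ) (a : ℕ),
        (fun i : Fin (n + 2) => W i ((Fin.cons a ν : Fin (n + 2) → ℕ) i)) =
          Matrix.vecCons (W 0 a) (fun i : Fin (n + 1) => W (i + 1) (ν i)) := by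
      intro ν a
      ext i
      refine Fin.cases ?_ (fun i => ?_) i <;> simp
    have step : ∀ ν : Fin (n + 1) → ℕ,
        ∑ a ∈ Finset.range (ν 0 + 1),
          f (fun i : Fin (n + 2) => W i ((Fin.cons a ν : Fin (n + 2) → ℕ) i)) =
        f.curryLeft (c 0) (fun i : Fin (n + 1) => W (i + 1) (ν i)) := by
      intro ν
      -- The subtracted term puts `W 1 (ν 0)` in slot 0, where it repeats slot 1.
      have hz : f.curryLeft (W 1 (ν 0)) (fun i : Fin (n + 1) => W (i + 1) (ν i)) = 0 := by
        rw [AlternatingMap.curryLeft_apply_apply]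
        exact f.map_eq_zero_of_eq _ (i := 0) (j := 1) (by simp) (by simp)
      simp only [split, ← AlternatingMap.curryLeft_apply_apply]
      have hsum : ∀ s : Finset ℕ, ∑ a ∈ s, f.curryLeft (W 0 a) (fun i => W (i + 1) (ν i)) =
          f.curryLeft (∑ a ∈ s, W 0 a) (fun i : Fin (n + 1) => W (i + 1) (ν i)) := by
        intro s
        induction s using Finset.cons_induction with
        | empty => simp
        | cons a s ha ihs => rw [Finset.sum_cons, Finset.sum_cons, ihs, map_add,
            AlternatingMap.add_apply]
      rw [hsum, h 0 (by omega), map_sub, AlternatingMap.sub_apply]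
      simp [hz]
    -- Slot 0 is now the constant `c 0`; currying it away leaves the same problem for the shifted
    -- families.
    rw [Finset.sum_congr rfl fun ν _ => step ν,
      ih (f.curryLeft (c 0)) (fun i => W (i + 1)) (fun i => c (i + 1))
        (fun i hi b => h (i + 1) (by omega) b), AlternatingMap.curryLeft_apply_apply]
    congr 1
    ext i
    refine Fin.cases ?_ (fun i => ?_) i <;> simp

/-! ### Unitriangular row operations. -/

theorem det_eq_det_of_unitriangular {R : Type*} [CommRing R] {n : ℕ}
    {A B : Matrix (Fin n) (Fin n) R}
    (h : ∀ i, ∃ t : Fin n → R, t i = 1 ∧ (∀ s, i < s → t s = 0) ∧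
      ∀ k, A i k = ∑ s, t s * B s k) : A.det = B.det := by
  choose t h1 h2 h3 using h
  have hA : A = Matrix.of t * B := by
    ext i k
    simp [Matrix.mul_apply, h3]
  rw [hA, Matrix.det_mul, Matrix.det_of_isLowerTriangular]
  · simp [h1]
  · intro i j hij
    exact h2 i j hij

/-- Polynomials `X ^ (n - 1 - i) * q i` in `w`, with `q i` of degree at most `i` and constant term
`1`, may be replaced by monomials in a determinant whose last row is known up to polynomials in `w`
of degree less than `n`. -/
theorem det_polynomial_rows {R : Type*} [CommRing R] {n : ℕ} (w P₀ : Fin (n + 1) → R)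
    (A : Matrix (Fin (n + 1)) (Fin (n + 1)) R) (q : ℕ → Polynomial R) (r : Polynomial R)
    (hdeg : ∀ i < n, (q i).natDegree ≤ i) (hcoeff : ∀ i < n, (q i).coeff 0 = 1)
    (hA : ∀ i : Fin (n + 1), i.val < n → ∀ k, A i k = w k ^ (n - 1 - i.val) * (q i).eval (w k))
    (hr : r.degree < n) (hlast : ∀ k, A (Fin.last n) k = P₀ k + r.eval (w k)) :
    A.det = (Matrix.of fun i k : Fin (n + 1) =>
      if i.val < n then w k ^ (n - 1 - i.val) else P₀ k).det := by
  apply det_eq_det_of_unitriangular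
  intro i
  by_cases hi : i.val < n
  -- Expanding `q i` in monomials, its coefficient of degree `i - s` multiplies w^(n - 1 - s), which
  -- is row `s` of the target; the diagonal coefficient is `(q i).coeff 0 = 1`.
  · refine ⟨fun s => if s.val ≤ i.val then (q i).coeff (i - s) else 0, by simp [hcoeff i hi],
      fun s hs => if_neg (by simpa using hs), fun k => ?_⟩
    rw [hA i hi, Polynomial.eval_eq_sum_range' (Nat.lt_succ_of_le (hdeg i hi)), Finset.mul_sum,
      ← Finset.sum_range_reflect]
    have hsum := Fin.sum_univ_eq_sum_range (fun s : ℕ =>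
      (if s ≤ i.val then (q i).coeff (i - s) else 0) *
        (if s < n then w k ^ (n - 1 - s) else P₀ k)) (n + 1)
    simp only [Matrix.of_apply]
    rw [hsum, ← Finset.sum_subset (Finset.range_subset_range.2 (by omega : i.val + 1 ≤ n + 1))]
    · refine Finset.sum_congr rfl fun s hs => ?_
      rw [Finset.mem_range] at hs
      rw [if_pos (by omega), if_pos (by omega), show i.val + 1 - 1 - s = i - s by omega,
        mul_left_comm, ← pow_add, show n - 1 - i.val + (i - s) = n - 1 - s by omega]
    · intro s _ hs
      rw [Finset.mem_range] at hs
      rw [if_neg (by omega), zero_mul]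
  · obtain rfl : i = Fin.last n := Fin.ext (by simp; omega)
    -- The monomial rows span all polynomials in w of degree below `n`, so they absorb `r`.
    refine ⟨fun s => if s.val < n then r.coeff (n - 1 - s) else 1, by simp,
      fun s hs => absurd hs (Fin.le_last s).not_gt, fun k => ?_⟩
    rw [hlast, Fin.sum_univ_castSucc]
    simp only [Matrix.of_apply, Fin.val_castSucc, Fin.is_lt, if_true, Fin.val_last, lt_irrefl,
      if_false, one_mul]
    rw [add_comm, Fin.sum_univ_eq_sum_range (fun s => r.coeff (n - 1 - s) * w k ^ (n - 1 - s)) n,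
      Finset.sum_range_reflect (fun s => r.coeff s * w k ^ s) n]
    rcases eq_or_ne r 0 with rfl | h0
    · simp
    · rw [Polynomial.eval_eq_sum_range' ((Polynomial.natDegree_lt_iff_degree_lt h0).2 hr)]

/-! ### The last row: geometric sums in 1 - w. -/

/-- Both sides are (1 - (1 - w)^M) / w formally; induction with Pascal's rule avoids the division,
so w = 0 is allowed. -/
theorem sum_range_one_sub_pow {R : Type*} [CommRing R] (w : R) (M : ℕ) :
    ∑ l ∈ Finset.range M, (1 - w) ^ l =
      ∑ m ∈ Finset.range M, (-1) ^ m * (M.choose (m + 1) : R) * w ^ m := by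
  induction M with
  | zero => simp
  | succ M ih =>
    have hpow : (1 - w) ^ M =
        ∑ m ∈ Finset.range (M + 1), (-1) ^ m * (M.choose m : R) * w ^ m := by
      rw [show (1 : R) - w = -w + 1 by ring, add_pow]
      refine Finset.sum_congr rfl fun m _ => ?_
      rw [neg_pow w]
      ring
    have hzero : ∑ m ∈ Finset.range (M + 1), (-1) ^ m * (M.choose (m + 1) : R) * w ^ m =
        ∑ m ∈ Finset.range M, (-1) ^ m * (M.choose (m + 1) : R) * w ^ m := by
      rw [Finset.sum_range_succ]
      simp
    rw [Finset.sum_range_succ, ih, hpow, ← hzero, ← Finset.sum_add_distrib]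
    refine Finset.sum_congr rfl fun m _ => ?_
    rw [Nat.choose_succ_succ]
    push_cast
    ring

open Polynomial in
-- The sum on the left is the full geometric sum of length L + n + 1 without its first n terms.
-- Expanding the full sum in powers of w, the tail of the expansion is the last row of V; everything
-- else has degree below n. For n = 0 the bound on `degree` forces r = 0, and the lower limit `max n
-- 1` excludes the power w^(-1).
theorem exists_polynomial_geom_tail {R : Type*} [CommRing R] (L n : ℕ) :
    ∃ r : R[X], r.degree < n ∧ ∀ w : R,
      ∑ a ∈ Finset.range (L + 1), (1 - w) ^ (a + n) =
        -∑ m ∈ Finset.Icc (max n 1) (L + n + 1),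
          (-1) ^ m * ((L + n + 1).choose m : R) * w ^ (m - 1) + r.eval w := by
  refine ⟨∑ m ∈ Finset.range (n - 1), C ((-1) ^ m * ((L + n + 1).choose (m + 1) : R)) * X ^ m -
    ∑ l ∈ Finset.range n, (1 - X) ^ l, ?_, fun w => ?_⟩
  · have hmem : ∀ p : R[X], p ∈ degreeLT R n ↔ p.degree < n := fun p => mem_degreeLT
    rw [← hmem]
    refine sub_mem (sum_mem fun m hm => ?_) (sum_mem fun l hl => ?_)
    · rw [Finset.mem_range] at hm
      rw [hmem]
      exact (degree_C_mul_X_pow_le _ _).trans_lt (by exact_mod_cast (by omega : m < n))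
    · rw [Finset.mem_range] at hl
      rw [hmem]
      have h1 : (1 - X : R[X]).natDegree ≤ 1 := by
        compute_degree
      refine degree_le_natDegree.trans_lt ?_
      have := natDegree_pow_le_of_le l h1
      exact_mod_cast (by omega : ((1 - X : R[X]) ^ l).natDegree < n)
  · have hgeom := sum_range_one_sub_pow w (L + n + 1)
    have hleft : ∑ l ∈ Finset.range (L + n + 1), (1 - w) ^ l =
        ∑ l ∈ Finset.range n, (1 - w) ^ l + ∑ a ∈ Finset.range (L + 1), (1 - w) ^ (a + n) := by
      rw [show L + n + 1 = n + (L + 1) by omega, Finset.sum_range_add]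
      simp only [add_comm n]
    have hright : ∑ m ∈ Finset.range (L + n + 1),
          (-1) ^ m * ((L + n + 1).choose (m + 1) : R) * w ^ m =
        ∑ m ∈ Finset.range (n - 1), (-1) ^ m * ((L + n + 1).choose (m + 1) : R) * w ^ m -
          ∑ m ∈ Finset.Icc (max n 1) (L + n + 1),
            (-1) ^ m * ((L + n + 1).choose m : R) * w ^ (m - 1) := by
      rw [← Finset.sum_range_add_sum_Ico _ (by omega : n - 1 ≤ L + n + 1), sub_eq_add_neg,
        ← Finset.sum_neg_distrib]
      congr 1
      refine Finset.sum_nbij' (fun m => m + 1) (fun m => m - 1) ?_ ?_ ?_ ?_ ?_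
      · intro m hm
        simp only [Finset.mem_Ico, Finset.mem_Icc] at hm ⊢
        omega
      · intro m hm
        simp only [Finset.mem_Ico, Finset.mem_Icc] at hm ⊢
        omega
      · intro m _
        rfl
      · intro m hm
        simp only [Finset.mem_Icc] at hm
        omega
      · intro m _
        rw [Nat.add_sub_cancel]
        ring
    rw [hleft, hright] at hgeom
    simp only [eval_sub, eval_finsetSum, eval_mul, eval_C, eval_pow, eval_X, eval_one]
    linear_combination hgeom

open Polynomial in
-- Here q_i is (1 - w)^i on one side and the truncation of (1 - w)^(L + n + 1) at degree i on the
-- other; only the degree bound and the constant term 1 matter.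
theorem det_geom_rows_eq {R : Type*} [CommRing R] (L n : ℕ) (w : Fin (n + 1) → R) :
    (Matrix.of fun i k : Fin (n + 1) =>
      if i.val < n then (1 - w k) ^ i.val * w k ^ (n - 1 - i.val)
      else ∑ a ∈ Finset.range (L + 1), (1 - w k) ^ (a + n)).det =
    (Matrix.of fun i k : Fin (n + 1) =>
      if i.val < n then w k ^ (n - 1 - i.val) * ∑ m ∈ Finset.range (i.val + 1),
        (-1) ^ m * ((L + n + 1).choose m : R) * w k ^ m
      else -∑ m ∈ Finset.Icc (max n 1) (L + n + 1),
        (-1) ^ m * ((L + n + 1).choose m : R) * w k ^ (m - 1)).det := by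
  obtain ⟨r, hr, hr'⟩ := exists_polynomial_geom_tail (R := R) L n
  refine (det_polynomial_rows w (fun k => -∑ m ∈ Finset.Icc (max n 1) (L + n + 1),
      (-1) ^ m * ((L + n + 1).choose m : R) * w k ^ (m - 1)) _ (fun i => (1 - X) ^ i) r
      ?_ ?_ ?_ hr ?_).trans
    (det_polynomial_rows w _ _
      (fun i => ∑ m ∈ Finset.range (i + 1), C ((-1) ^ m * ((L + n + 1).choose m : R)) * X ^ m) 0
      ?_ ?_ ?_ ?_ ?_).symm
  · intro i _
    have h1 : (1 - X : R[X]).natDegree ≤ 1 := by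
      compute_degree
    simpa using natDegree_pow_le_of_le i h1
  · intro i _
    simp [coeff_zero_eq_eval_zero]
  · intro i hi k
    simp [hi, mul_comm]
  · intro k
    simp [hr']
  · intro i _
    refine natDegree_sum_le_of_forall_le _ _ fun m hm => ?_
    rw [Finset.mem_range] at hm
    exact (natDegree_C_mul_X_pow_le _ _).trans (by omega)
  · intro i _
    simp only [finsetSum_coeff, coeff_C_mul_X_pow]
    rw [Finset.sum_eq_single 0] <;> simp +contextual [eq_comm]
  · intro i hi k
    simp [hi, eval_finsetSum]
  · simp
  · intro k
    simp

theorem sum_monotoneBox_det {R : Type*} [CommRing R] (L n : ℕ) (w : Fin (n + 1) → R) :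
    ∑ ν ∈ monotoneBox L (n + 1), (Matrix.of fun i k : Fin (n + 1) =>
      (1 - w k) ^ (ν i + i.val) * w k ^ (n - i.val)).det =
    (Matrix.of fun i k : Fin (n + 1) =>
      if i.val < n then (1 - w k) ^ i.val * w k ^ (n - 1 - i.val)
      else ∑ a ∈ Finset.range (L + 1), (1 - w k) ^ (a + n)).det := by
  have h := sum_monotoneBox_alternatingMap L n
    (Matrix.detRowAlternating : (Fin (n + 1) → R) [⋀^Fin (n + 1)]→ₗ[R] R)
    (fun i a k => (1 - w k) ^ (a + i) * w k ^ (n - i))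
    (fun i k => (1 - w k) ^ i * w k ^ (n - 1 - i)) ?_
  · refine h.trans ?_
    change Matrix.det _ = _
    congr 1
    ext i k
    by_cases hi : i.val < n <;> simp [hi]
  -- The geometric sum contributes 1 - (1 - w)^(b + 1) once one factor w is taken from w^(n - i).
  · intro i hi b
    ext k
    have hg := geom_sum_mul (1 - w k) (b + 1)
    simp only [Finset.sum_apply, Pi.sub_apply, pow_add _ _ i, ← Finset.sum_mul]
    rw [show n - i = n - 1 - i + 1 by omega, show n - (i + 1) = n - 1 - i by omega]
    linear_combination (-(1 - w k) ^ i * w k ^ (n - 1 - i)) * hg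

/-! ### Reversal of indices, complements and signs. -/

/-- Reversal inverts every pair i < j. The sign is kept as a product over pairs because the same
product converts the factors z_j - z_k into z_k - z_j. -/
theorem sign_revPerm (n : ℕ) {R : Type*} [CommRing R] :
    ((Equiv.Perm.sign (Fin.revPerm : Equiv.Perm (Fin n)) : ℤ) : R) =
      ∏ i : Fin n, ∏ _j ∈ Finset.Ioi i, (-1 : R) := by
  rw [Equiv.Perm.sign_eq_prod_prod_Ioi]
  push_cast
  refine Finset.prod_congr rfl fun i _ => Finset.prod_congr rfl fun j hj => ?_
  rw [Finset.mem_Ioi] at hj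
  rw [if_neg (by simpa using hj.le)]
  simp

theorem sum_boxPartitions_rev {F : Type*} [AddCommMonoid F] (L n : ℕ) (g : (Fin n → ℕ) → F) :
    ∑ μ ∈ boxPartitions L n, g μ = ∑ ν ∈ monotoneBox L n, g (fun i => ν i.rev) := by
  refine Finset.sum_nbij' (fun μ i => μ i.rev) (fun ν i => ν i.rev) ?_ ?_ ?_ ?_ ?_
  · intro μ hμ
    rw [mem_boxPartitions] at hμ
    exact mem_monotoneBox.2 ⟨fun i => hμ.1 _, fun i j hij => hμ.2 _ _ (Fin.rev_le_rev.2 hij)⟩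
  · intro ν hν
    rw [mem_monotoneBox] at hν
    exact mem_boxPartitions.2 ⟨fun i => hν.1 _, fun i j hij => hν.2 _ _ (Fin.rev_le_rev.2 hij)⟩
  all_goals simp

theorem sum_boxPartitions_compl {F : Type*} [AddCommMonoid F] (L n : ℕ) (g : (Fin n → ℕ) → F) :
    ∑ μ ∈ boxPartitions L n, g μ = ∑ μ ∈ boxPartitions L n, g (fun i => L - μ i.rev) := by
  refine Finset.sum_nbij' (fun μ i => L - μ i.rev) (fun μ i => L - μ i.rev) ?_ ?_ ?_ ?_ ?_
  · intro μ hμ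
    rw [mem_boxPartitions] at hμ ⊢
    exact ⟨fun i => Nat.sub_le _ _,
      fun i j hij => Nat.sub_le_sub_left (hμ.2 _ _ (Fin.rev_le_rev.2 hij)) _⟩
  · intro μ hμ
    rw [mem_boxPartitions] at hμ ⊢
    exact ⟨fun i => Nat.sub_le _ _,
      fun i j hij => Nat.sub_le_sub_left (hμ.2 _ _ (Fin.rev_le_rev.2 hij)) _⟩
  all_goals
    intro μ hμ
    rw [mem_boxPartitions] at hμ
    simp [Nat.sub_sub_self (hμ.1 _)]

theorem prod_prod_one_div_sub {K : Type*} [Field K] {n : ℕ} (z : Fin n → K) :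
    ∏ j : Fin n, ∏ k ∈ Finset.Ioi j, 1 / (z k - z j) =
      (∏ i : Fin n, ∏ _j ∈ Finset.Ioi i, (-1 : K)) / diffProd z := by
  rw [diffProd, ← Finset.prod_div_distrib]
  refine Finset.prod_congr rfl fun j _ => ?_
  rw [← Finset.prod_div_distrib]
  refine Finset.prod_congr rfl fun k _ => ?_
  rw [← neg_sub (z j), one_div, neg_div, one_div, inv_neg]

/-! ### The identity for Grothendieck polynomials. -/

theorem vMatrix_det_eq {K : Type*} [Field K] (L n : ℕ) (β : K) (z : Fin (n + 1) → K) :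
    (vMatrix (L + n + 1) β z).det = (∏ i : Fin (n + 1), (-β) ^ ((i.val : ℤ) - n)) *
      (Matrix.of fun i k : Fin (n + 1) =>
        if i.val < n then (1 + β * z k) ^ (n - 1 - i.val) * ∑ m ∈ Finset.range (i.val + 1),
          (-1) ^ m * ((L + n + 1).choose m : K) * (1 + β * z k) ^ m
        else -∑ m ∈ Finset.Icc (max n 1) (L + n + 1),
          (-1) ^ m * ((L + n + 1).choose m : K) * (1 + β * z k) ^ (m - 1)).det := by
  rw [← Matrix.det_mul_column]
  congr 1
  ext i k
  simp only [vMatrix, Matrix.of_apply, vEntry, Nat.add_lt_add_iff_right, Nat.add_sub_cancel]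
  split_ifs with hi
  · rw [Finset.mul_sum, Finset.mul_sum]
    refine Finset.sum_congr rfl fun m hm => ?_
    rw [show ((m : ℤ) - ((i.val + 1 : ℕ) : ℤ) + ((n + 1 : ℕ) : ℤ) - 1) =
        ((n - 1 - i.val + m : ℕ) : ℤ) by omega, zpow_natCast, pow_add,
      show ((i.val + 1 : ℕ) : ℤ) - ((n + 1 : ℕ) : ℤ) = (i.val : ℤ) - n by push_cast; ring]
    ring
  -- In the last row i = n, so the extracted power of -β is trivial; there m ≥ 1, so the exponent m
  -- - 1 is a natural number.
  · rw [show (i.val : ℤ) - n = 0 by omega, zpow_zero, one_mul]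
    congr 1
    refine Finset.sum_congr rfl fun m hm => ?_
    rw [Finset.mem_Icc] at hm
    rw [show (m : ℤ) - 1 = ((m - 1 : ℕ) : ℤ) by omega, zpow_natCast]

theorem sum_boxPartitions_det {K : Type*} [Field K] (L n : ℕ) {β : K} (hβ : β ≠ 0)
    (z : Fin (n + 1) → K) :
    ∑ μ ∈ boxPartitions L (n + 1), (-β) ^ (∑ j, μ j) *
      (Matrix.of fun j k : Fin (n + 1) =>
        z j ^ (μ k + (n + 1 - (k.val + 1))) * (1 + β * z j) ^ k.val).det =
    (∏ i : Fin (n + 1), ∏ _j ∈ Finset.Ioi i, (-1 : K)) * (vMatrix (L + n + 1) β z).det := by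
  have hb : -β ≠ 0 := neg_ne_zero.2 hβ
  have hprod : ∏ i : Fin (n + 1), (-β) ^ ((i.val : ℤ) - n) =
      (∏ i : Fin (n + 1), (-β) ^ i.val)⁻¹ := by
    rw [← Equiv.prod_comp Fin.revPerm, ← Finset.prod_inv_distrib]
    refine Finset.prod_congr rfl fun i _ => ?_
    rw [Fin.revPerm_apply, Fin.val_rev, ← zpow_natCast, ← zpow_neg]
    congr 1
    omega
  have hprod0 : ∏ i : Fin (n + 1), (-β) ^ i.val ≠ 0 :=
    Finset.prod_ne_zero_iff.2 fun i _ => pow_ne_zero _ hb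
  rw [sum_boxPartitions_rev, vMatrix_det_eq, ← det_geom_rows_eq, ← sum_monotoneBox_det, hprod,
    Finset.mul_sum, Finset.mul_sum]
  refine Finset.sum_congr rfl fun ν _ => ?_
  have hrev : (Matrix.of fun j k : Fin (n + 1) =>
      z j ^ (ν k.rev + (n + 1 - (k.val + 1))) * (1 + β * z j) ^ k.val).det =
      (∏ i : Fin (n + 1), ∏ _j ∈ Finset.Ioi i, (-1 : K)) * (Matrix.of fun i k : Fin (n + 1) =>
        z k ^ (ν i + i.val) * (1 + β * z k) ^ (n - i.val)).det := by
    rw [← sign_revPerm, ← Matrix.det_permute, ← Matrix.det_transpose]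
    congr 1
    ext k j
    simp only [Matrix.transpose_apply, Matrix.of_apply, Matrix.submatrix_apply, id_eq,
      Fin.revPerm_apply, Fin.val_rev]
    congr 2
    omega
  -- Row i absorbs (-β)^(ν_i + i), turning z into 1 - w; the factor (-β)^i left over cancels the
  -- powers taken out of V.
  have hscale : (Matrix.of fun i k : Fin (n + 1) =>
      (1 - (1 + β * z k)) ^ (ν i + i.val) * (1 + β * z k) ^ (n - i.val)).det =
      ((-β) ^ (∑ i, ν i) * ∏ i : Fin (n + 1), (-β) ^ i.val) *
        (Matrix.of fun i k : Fin (n + 1) =>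
          z k ^ (ν i + i.val) * (1 + β * z k) ^ (n - i.val)).det := by
    rw [← Finset.prod_pow_eq_pow_sum, ← Finset.prod_mul_distrib, ← Matrix.det_mul_column]
    congr 1
    ext i k
    simp only [Matrix.of_apply]
    rw [show 1 - (1 + β * z k) = -β * z k by ring, mul_pow, ← pow_add, mul_assoc]
  have hsum : ∑ j : Fin (n + 1), ν j.rev = ∑ j, ν j := Equiv.sum_comp Fin.revPerm ν
  rw [hrev, hscale, hsum]
  field_simp

/-! ### The identity for dual Grothendieck polynomials. -/

theorem vTildeEntry_eq {K : Type*} [Field K] (L n : ℕ) {β : K} (hβ : β ≠ 0) {y : K}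
    (hw : 1 + β * y⁻¹ ≠ 0) (i : ℕ) (hi : i ≤ n) :
    vTildeEntry (L + n + 1) (n + 1) β (i + 1) y =
      (-β) ^ (-(L : ℤ)) * ((1 + β * y⁻¹) ^ (-(n : ℤ)) *
        vEntry (L + n + 1) (n + 1) β (n - i + 1) y⁻¹) := by
  have hb : -β ≠ 0 := neg_ne_zero.2 hβ
  unfold vTildeEntry vEntry
  by_cases h : 2 ≤ i + 1
  · rw [if_pos h, if_pos (by omega), show n + 1 - (i + 1) + 1 = n - i + 1 by omega,
      Finset.mul_sum, Finset.mul_sum]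
    refine Finset.sum_congr rfl fun m _ => ?_
    rw [show -((i + 1 : ℕ) : ℤ) + 1 - ((L + n + 1 : ℕ) : ℤ) + ((n + 1 : ℕ) : ℤ) =
        -(L : ℤ) + (((n - i + 1 : ℕ) : ℤ) - ((n + 1 : ℕ) : ℤ)) by omega, zpow_add₀ hb,
      show (m : ℤ) + ((i + 1 : ℕ) : ℤ) - ((n + 1 : ℕ) : ℤ) - 1 =
        -(n : ℤ) + ((m : ℤ) - ((n - i + 1 : ℕ) : ℤ) + ((n + 1 : ℕ) : ℤ) - 1) by omega,
      zpow_add₀ hw]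
    ring
  · rw [if_neg h, if_neg (by omega), mul_neg, mul_neg, Finset.mul_sum, Finset.mul_sum]
    congr 1
    refine Finset.sum_congr rfl fun m _ => ?_
    rw [show -((L + n + 1 : ℕ) : ℤ) + ((n + 1 : ℕ) : ℤ) = -(L : ℤ) by omega,
      show (m : ℤ) - ((n + 1 : ℕ) : ℤ) = -(n : ℤ) + ((m : ℤ) - 1) by omega, zpow_add₀ hw]
    ring

/-- Ṽ is V at 1/y with its rows reversed, each row scaled by (-β)^(-L) and each column by w^(-n),
where now w = 1 + β/y. -/
theorem vTildeMatrix_det_eq {K : Type*} [Field K] (L n : ℕ) {β : K} (hβ : β ≠ 0)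
    (y : Fin (n + 1) → K) (hw : ∀ j, 1 + β * (y j)⁻¹ ≠ 0) :
    (vTildeMatrix (L + n + 1) β y).det =
      (-β) ^ (-((L * (n + 1) : ℕ) : ℤ)) * ((∏ k, (1 + β * (y k)⁻¹) ^ (-(n : ℤ))) *
        ((∏ i : Fin (n + 1), ∏ _j ∈ Finset.Ioi i, (-1 : K)) *
          (vMatrix (L + n + 1) β fun j => (y j)⁻¹).det)) := by
  have hc : (-β) ^ (-((L * (n + 1) : ℕ) : ℤ)) = ∏ _i : Fin (n + 1), (-β) ^ (-(L : ℤ)) := by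
    rw [Finset.prod_const, Finset.card_univ, Fintype.card_fin, ← zpow_natCast, ← zpow_mul]
    push_cast
    ring_nf
  rw [hc, ← sign_revPerm, ← Matrix.det_permute, ← Matrix.det_mul_row, ← Matrix.det_mul_column]
  congr 1
  ext i k
  simp only [vTildeMatrix, vMatrix, Matrix.of_apply, Matrix.submatrix_apply, id_eq,
    Fin.revPerm_apply, Fin.val_rev]
  rw [vTildeEntry_eq L n hβ (hw k) i (by omega), Nat.add_sub_add_right]

/-- Passing to the complement changes |λ| into L(n + 1) - |λ| and, after extraction of y^(L + n) and
w^(-n) from each row, yields the determinant of (1) at 1/y with its columns reversed. -/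
theorem sum_boxPartitions_dual_det {K : Type*} [Field K] (L n : ℕ) {β : K} (hβ : β ≠ 0)
    (y : Fin (n + 1) → K) (hy : ∀ j, y j ≠ 0) (hw : ∀ j, 1 + β * (y j)⁻¹ ≠ 0) :
    ∑ μ ∈ boxPartitions L (n + 1), (-β) ^ (-((∑ j, μ j : ℕ) : ℤ)) *
      (Matrix.of fun j k : Fin (n + 1) => y j ^ (μ k + (n + 1 - (k.val + 1))) *
        (1 + β * (y j)⁻¹) ^ (1 - ((k.val : ℤ) + 1))).det =
    (∏ j, y j ^ (L + n)) * ((∏ i : Fin (n + 1), ∏ _j ∈ Finset.Ioi i, (-1 : K)) *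
      (vTildeMatrix (L + n + 1) β y).det) := by
  have hb : -β ≠ 0 := neg_ne_zero.2 hβ
  rw [vTildeMatrix_det_eq L n hβ y hw, ← sum_boxPartitions_det L n hβ fun j => (y j)⁻¹,
    sum_boxPartitions_compl]
  simp only [Finset.mul_sum]
  refine Finset.sum_congr rfl fun μ hμ => ?_
  rw [mem_boxPartitions] at hμ
  have hsum : ∑ j : Fin (n + 1), (L - μ j.rev) + ∑ j, μ j = L * (n + 1) := by
    rw [← Equiv.sum_comp Fin.revPerm μ, ← Finset.sum_add_distrib]
    simp only [Fin.revPerm_apply]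
    rw [Finset.sum_congr rfl fun j _ => Nat.sub_add_cancel (hμ.1 (Fin.rev j))]
    simp [mul_comm]
  have hpow : (-β) ^ (-((∑ j : Fin (n + 1), (L - μ j.rev) : ℕ) : ℤ)) =
      (-β) ^ (-((L * (n + 1) : ℕ) : ℤ)) * (-β) ^ (∑ j, μ j) := by
    rw [← hsum, ← zpow_natCast (-β) (∑ j, μ j), ← zpow_add₀ hb]
    congr 1
    push_cast
    ring
  have hdet : (Matrix.of fun j k : Fin (n + 1) => y j ^ (L - μ k.rev + (n + 1 - (k.val + 1))) *
        (1 + β * (y j)⁻¹) ^ (1 - ((k.val : ℤ) + 1))).det =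
      (∏ j, y j ^ (L + n)) * ((∏ k, (1 + β * (y k)⁻¹) ^ (-(n : ℤ))) *
        ((∏ i : Fin (n + 1), ∏ _j ∈ Finset.Ioi i, (-1 : K)) *
          (Matrix.of fun j k : Fin (n + 1) => (y j)⁻¹ ^ (μ k + (n + 1 - (k.val + 1))) *
            (1 + β * (y j)⁻¹) ^ k.val).det)) := by
    rw [← sign_revPerm, ← Matrix.det_permute', ← Matrix.det_mul_column, ← Matrix.det_mul_column]
    congr 1
    ext j k
    simp only [Matrix.of_apply, Matrix.submatrix_apply, id_eq, Fin.revPerm_apply, Fin.val_rev]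
    have hk := k.is_lt
    have hμk := hμ.1 k.rev
    have h1 : (1 + β * (y j)⁻¹) ^ (1 - ((k.val : ℤ) + 1)) =
        (1 + β * (y j)⁻¹) ^ (-(n : ℤ)) * (1 + β * (y j)⁻¹) ^ (n + 1 - (k.val + 1)) := by
      rw [← zpow_natCast, ← zpow_add₀ (hw j)]
      congr 1
      omega
    -- The second exponent is that of 1/y in the reversed column, which has index n - k.
    have h2 : y j ^ (L + n) = y j ^ (L - μ k.rev + (n + 1 - (k.val + 1))) *
        y j ^ (μ k.rev + (n + 1 - (n + 1 - (k.val + 1) + 1))) := by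
      rw [← pow_add]
      congr 1
      omega
    rw [h1, h2, inv_pow]
    have h3 := pow_ne_zero (μ k.rev + (n + 1 - (n + 1 - (k.val + 1) + 1))) (hy j)
    field_simp
  rw [hpow, hdet]
  ring

theorem mainTheorem8 {K : Type*} [Field K] (M N : ℕ) (hNM : N ≤ M) (β : K) (hβ : β ≠ 0) :
    (∀ z : Fin N → K, Function.Injective z →
      ∑ μ ∈ boxPartitions (M - N) N, (-β) ^ (∑ j, μ j) * grothendieck μ z β =
        (∏ j : Fin N, ∏ k ∈ Finset.Ioi j, 1 / (z k - z j)) * (vMatrix M β z).det) ∧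
    (∀ y : Fin N → K, Function.Injective y → (∀ j, y j ≠ 0) → (∀ j, 1 + β * (y j)⁻¹ ≠ 0) →
      ∑ μ ∈ boxPartitions (M - N) N, (-β) ^ (-((∑ j, μ j : ℕ) : ℤ)) * dualGrothendieck μ y β =
        (∏ j : Fin N, y j ^ ((M : ℤ) - 1)) *
          (∏ j : Fin N, ∏ k ∈ Finset.Ioi j, 1 / (y k - y j)) * (vTildeMatrix M β y).det) := by

  rcases N with _ | n
  -- For N = 0 only the empty sequence occurs and all determinants and products equal 1.
  · have hbox : boxPartitions M 0 = {fun i => i.elim0} := by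
      ext μ
      simp [mem_boxPartitions, Subsingleton.elim μ fun i => i.elim0]
    simp [hbox, grothendieck, dualGrothendieck, diffProd]
  obtain ⟨L, rfl⟩ := Nat.exists_eq_add_of_le' hNM
  rw [Nat.add_sub_cancel, ← add_assoc]
  refine ⟨fun z _ => ?_, fun y _ hy hw => ?_⟩
  · rw [prod_prod_one_div_sub, div_mul_eq_mul_div, ← sum_boxPartitions_det L n hβ, Finset.sum_div]
    exact Finset.sum_congr rfl fun μ _ => by rw [grothendieck, mul_div_assoc]
  · have hexp : ((L + n + 1 : ℕ) : ℤ) - 1 = ((L + n : ℕ) : ℤ) := by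
      push_cast
      ring
    rw [prod_prod_one_div_sub, hexp]
    simp only [zpow_natCast]
    rw [mul_div_assoc', div_mul_eq_mul_div, mul_assoc,
      ← sum_boxPartitions_dual_det L n hβ y hy hw, Finset.sum_div]
    exact Finset.sum_congr rfl fun μ _ => by rw [dualGrothendieck, mul_div_assoc]
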